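/- Let $A=\{a,b\}$ be a two-letter alphabet and $A^*$ the free monoid on $A$. A \emph{code} is a set $C\subseteq A^*$ such that $c_1\cdots c_h=c'_1\cdots c'_k$ with all $c_i,c'_j\in C$ and $h,k\ge 0$ implies $h=k$ and $c_i=c'_i$ for all $i$; it is \emph{maximal} if it is not properly contained in any other code over $A$. Let $\mathbb{Z}\langle A\rangle$ be the ring of polynomials with integer coefficients in the noncommuting variables $a,b$. For $P\in\mathbb{Z}\langle A\rangle$ let $\operatorname{supp}(P)$ be the set of words with nonzero coefficient in $P$ and, for $g\ge 0$, let $P_g$ be the sum of the terms of $P$ whose words contain exactly $g$ occurrences of $b$. A \emph{factorization} for a finite maximal code $C$ is a pair $(P,S)$ of polynomials in $\mathbb{Z}\langle A\rangle$ with $$\sum_{w\in C} w = P\,(a+b-1)\,S+1 .$$ Theorem. Let $C$ be a finite maximal code over $A$ such that $a^p\in C$ for some prime number $p$. Let $(P,S)$ be a factorization for $C$ such that $S=S_0+S_1$ and such that, for all $i,j\ge 0$, $a^iba^j\in\operatorname{supp}(S)$ implies $a^j\in\operatorname{supp}(S)$. Then $(P,S)$ is positive: either $P$ and $S$ both have all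 their coefficients in $\{0,1\}$, or $-P$ and $-S$ both have all their coefficients in $\{0,1\}$. -/

import Mathlib

namespace FactorizationConjecture

/-- The two-letter alphabet `A = {a, b}`. -/
inductive Letter : Type
  | a : Letter
  | b : Letter
  deriving DecidableEq

/-- Words over `A`: the elements of the free monoid `A*`. -/
abbrev Word : Type := FreeMonoid Letter

/-- The letter `a`, as a word. -/
abbrev wa : Word := FreeMonoid.of Letter.a

/-- The letter `b`, as a word. -/
abbrev wb : Word := FreeMonoid.of Letter.b

/-- The number of occurrences of the letter `b` in the word `w`. -/
def bCount (w : Word) : ℕ := (FreeMonoid.toList w).count Letter.b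

/-- `C` is a code: two products of elements of `C` which are equal as words
have the same factors in the same order. -/
def IsCode (C : Set Word) : Prop :=
  InformationTheory.UniquelyDecodable (FreeMonoid.toList '' C)

/-- `C` is a maximal code: a code which is not properly contained in any other code
(finite or infinite) over `A`. -/
def IsMaximalCode (C : Set Word) : Prop := Maximal IsCode C

/-- Polynomials with integer coefficients in the noncommuting variables `a`, `b`:
the monoid ring of the free monoid `A*`. -/
abbrev NCPoly : Type := MonoidAlgebra ℤ Word

/-- The word `w`, as a polynomial. -/
noncomputable def mono (w : Word) : NCPoly := MonoidAlgebra.of ℤ Word w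

/-- The characteristic polynomial of a finite set of words, the sum of its elements. -/
noncomputable def charPoly (X : Finset Word) : NCPoly := ∑ x ∈ X, mono x

/-- The set of words having a nonzero coefficient in `P`. -/
def supp (P : NCPoly) : Set Word := {w | P.coeff w ≠ 0}

/-- `P_g`: the sum of the terms of `P` whose words have exactly `g` occurrences of `b`. -/
noncomputable def bPart (g : ℕ) (P : NCPoly) : NCPoly :=
  MonoidAlgebra.ofCoeff (P.coeff.filter fun w => bCount w = g)

/-- `(P, S)` is a factorization for the finite set of words `C`: the characteristic polynomial
of `C` equals `P (a + b - 1) S + 1`. -/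
def IsFactorization (C : Finset Word) (P S : NCPoly) : Prop :=
  charPoly C = P * (mono wa + mono wb - 1) * S + 1

/-- All coefficients of `P` are `0` or `1`. -/
def HasZeroOneCoeffs (P : NCPoly) : Prop := ∀ w : Word, P.coeff w = 0 ∨ P.coeff w = 1

/-- A pair `(P, S)` is positive if `P, S` or `-P, -S` have coefficients `0, 1`. -/
def IsPositivePair (P S : NCPoly) : Prop :=
  (HasZeroOneCoeffs P ∧ HasZeroOneCoeffs S) ∨ (HasZeroOneCoeffs (-P) ∧ HasZeroOneCoeffs (-S))

end FactorizationConjecture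

/-!
Write `A = a + b`, and let `P₀`, `S₀` be the parts of `P`, `S` without the letter `b`. Since powers
of `a` commute, `a ^ p` is the only power of `a` in the code, so setting `b = 0` in the
factorization gives `P₀ S₀ = 1 + a + ⋯ + a ^ (p - 1)`. This is a cyclotomic polynomial, hence
irreducible; up to a common sign of `P` and `S`, `S₀ = 1 + a + ⋯ + a ^ (n - 1)` with `n = 1` or
`n = p`, and both constant terms are `1` (`exists_coeff_wa_pow_eq`).

* The hypothesis on supports says that the other words of `S` end in `b a ^ j` with `j < n`, so that
  comparing the coefficients of `x a ^ n` gives `C(x a ^ n) = P(x) - P(x a ^ n)`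
  (`coeff_charPoly_mul_wa_pow`). Hence the coefficients of `P` decrease along
  `x, x a ^ n, x a ^ (2 n), …`, and they vanish eventually: `P` is nonnegative.
* If `x` is a word of `P` with the largest number of letters `b` and `y` has exactly one `b`, then
  `C(x b y) = P(x) S(y)` (`coeff_charPoly_mul_wb_mul`), so `S` is nonnegative too.
* Nonnegativity suffices (`hasZeroOneCoeffs_of_isNonneg`): in power series `A* = S C* P`, where all
  coefficients of `A*` are `1` and those of `S C* P` are at least those of `P` and of `S`.
-/

namespace FactorizationConjecture

open FreeMonoid Polynomial

/-! ### Coefficients of products -/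

instance : DecidableEq Word := inferInstanceAs (DecidableEq (List Letter))

lemma mono_eq_single (w : Word) : mono w = MonoidAlgebra.single w 1 := rfl

lemma mono_mul (u v : Word) : mono (u * v) = mono u * mono v := map_mul _ _ _

lemma mono_pow (u : Word) (n : ℕ) : mono (u ^ n) = mono u ^ n := map_pow _ _ _

lemma coeff_mono (u w : Word) : (mono u).coeff w = if u = w then 1 else 0 := by
  rw [mono_eq_single, MonoidAlgebra.coeff_single, Finsupp.single_apply]

lemma coeff_one (w : Word) : (1 : NCPoly).coeff w = if 1 = w then 1 else 0 := by
  rw [MonoidAlgebra.one_def, MonoidAlgebra.coeff_single, Finsupp.single_apply]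

lemma coeff_charPoly (X : Finset Word) (w : Word) :
    (charPoly X).coeff w = if w ∈ X then 1 else 0 := by
  simp [charPoly, Finsupp.finsetSum_apply, coeff_mono]

lemma coeff_mul_mono (P : NCPoly) (x u : Word) : (P * mono u).coeff (x * u) = P.coeff x := by
  rw [mono_eq_single, MonoidAlgebra.coeff_mul_single_eq_coeff_mul (m₂ := x), mul_one]
  exact fun _ _ => mul_left_inj u

lemma exists_of_coeff_mul_ne_zero {X Y : NCPoly} {w : Word} (h : (X * Y).coeff w ≠ 0) :
    ∃ u v, u * v = w ∧ X.coeff u ≠ 0 ∧ Y.coeff v ≠ 0 := by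
  have := MonoidAlgebra.support_coeff_mul_subset X Y (Finsupp.mem_support_iff.2 h)
  obtain ⟨u, hu, v, hv, rfl⟩ := Finset.mem_mul.1 this
  exact ⟨u, v, rfl, Finsupp.mem_support_iff.1 hu, Finsupp.mem_support_iff.1 hv⟩

lemma coeff_mul_eq_zero {X Y : NCPoly} {w : Word}
    (h : ∀ u v, u * v = w → X.coeff u ≠ 0 → Y.coeff v = 0) : (X * Y).coeff w = 0 := by
  by_contra hne
  obtain ⟨u, v, huv, hu, hv⟩ := exists_of_coeff_mul_ne_zero hne
  exact hv (h u v huv hu)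

/-! ### Words and occurrences of `b` -/

lemma bCount_mul (u v : Word) : bCount (u * v) = bCount u + bCount v := by
  simp [bCount, toList_mul]

lemma bCount_one : bCount 1 = 0 := rfl

lemma bCount_wa : bCount wa = 0 := rfl

lemma bCount_wb : bCount wb = 1 := rfl

lemma bCount_wa_pow (n : ℕ) : bCount (wa ^ n) = 0 := by
  induction n with
  | zero => rfl
  | succ n ih => rw [pow_succ, bCount_mul, ih, bCount_wa]

lemma exists_eq_wa_pow {w : Word} (h : bCount w = 0) : ∃ k, w = wa ^ k := by
  induction w using FreeMonoid.inductionOn' with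
  | one => exact ⟨0, rfl⟩
  | of_mul l w ih =>
    rw [bCount_mul] at h
    obtain ⟨k, rfl⟩ := ih (by omega)
    cases l with
    | a => exact ⟨k + 1, (pow_succ' _ _).symm⟩
    | b => exact absurd h (by rw [show bCount (of Letter.b) = 1 from rfl]; omega)

lemma exists_eq_wa_pow_mul {w : Word} (h : bCount w = 1) :
    ∃ i j, w = wa ^ i * wb * wa ^ j := by
  induction w using FreeMonoid.inductionOn' with
  | one => simp [bCount_one] at h
  | of_mul l w ih =>
    rw [bCount_mul] at h
    cases l with
    | a =>
      rw [show bCount (of Letter.a) = 0 from rfl, zero_add] at h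
      obtain ⟨i, j, rfl⟩ := ih h
      exact ⟨i + 1, j, by simp only [pow_succ', mul_assoc]⟩
    | b =>
      rw [show bCount (of Letter.b) = 1 from rfl] at h
      obtain ⟨k, rfl⟩ := exists_eq_wa_pow (w := w) (by omega)
      exact ⟨0, k, by simp⟩

lemma length_wa_pow (n : ℕ) : (wa ^ n).length = n := by
  induction n with
  | zero => rfl
  | succ n ih => rw [pow_succ, length_mul, ih]; rfl

lemma wa_pow_injective : Function.Injective fun n : ℕ => wa ^ n := fun m n h => by
  simpa [length_wa_pow] using congrArg FreeMonoid.length h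

lemma mul_of_inj {u v : Word} {l m : Letter} (h : u * of l = v * of m) : u = v ∧ l = m := by
  have h' := congrArg toList h
  simp only [toList_mul, toList_of] at h'
  obtain ⟨h1, h2⟩ := List.append_inj' h' rfl
  exact ⟨toList.injective h1, by simpa using h2⟩

/-- A word ending in `b` followed by fewer than `n` letters `a` does not end in `a ^ n`. -/
lemma mul_wb_mul_wa_pow_ne {j n : ℕ} (hj : j < n) (z x : Word) :
    z * wb * wa ^ j ≠ x * wa ^ n := by
  obtain ⟨k, rfl⟩ := Nat.exists_eq_add_of_lt hj
  intro h
  rw [show j + k + 1 = k + 1 + j by omega, pow_add, ← mul_assoc x, mul_left_inj, pow_succ,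
    ← mul_assoc] at h
  exact absurd (mul_of_inj h).2 (by decide)

/-- An occurrence of `b` in a word is determined by the number of letters `b` to its left. -/
lemma mul_wb_mul_inj {x x' y y' : Word} (hx : bCount x = bCount x')
    (h : x * wb * y = x' * wb * y') : x = x' ∧ y = y' := by
  have key : ∀ {x x' y y' : List Letter}, x.count Letter.b = x'.count Letter.b →
      x ++ Letter.b :: y = x' ++ Letter.b :: y' → x = x' ∧ y = y' := by
    intro x
    induction x with
    | nil =>
      rintro (_ | ⟨l, x'⟩) y y' hc he
      · simpa using he
      · obtain ⟨rfl, -⟩ := List.cons.inj he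
        simp at hc
    | cons m x ih =>
      rintro (_ | ⟨l, x'⟩) y y' hc he
      · obtain ⟨rfl, -⟩ := List.cons.inj he
        simp at hc
      · obtain ⟨rfl, he'⟩ := List.cons.inj he
        rw [List.count_cons, List.count_cons, Nat.add_right_cancel_iff] at hc
        obtain ⟨rfl, rfl⟩ := ih hc he'
        exact ⟨rfl, rfl⟩
  have h' := congrArg toList h
  simp only [toList_mul, toList_of, List.append_assoc, List.singleton_append] at h'
  obtain ⟨h1, h2⟩ := key hx h'
  exact ⟨toList.injective h1, toList.injective h2⟩

/-! ### Nonnegative factorizations have coefficients zero and one -/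

/-- All coefficients of `P` are nonnegative. -/
def IsNonneg (P : NCPoly) : Prop := ∀ w, 0 ≤ P.coeff w

lemma IsNonneg.mul {X Y : NCPoly} (hX : IsNonneg X) (hY : IsNonneg Y) : IsNonneg (X * Y) := by
  intro w
  rw [MonoidAlgebra.coeff_mul]
  refine Finset.sum_nonneg fun u _ => Finset.sum_nonneg fun v _ => ?_
  dsimp only
  split_ifs
  exacts [mul_nonneg (hX u) (hY v), le_rfl]

lemma IsNonneg.add {X Y : NCPoly} (hX : IsNonneg X) (hY : IsNonneg Y) : IsNonneg (X + Y) :=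
  fun w => add_nonneg (hX w) (hY w)

lemma isNonneg_one : IsNonneg 1 := fun w => by rw [coeff_one]; split_ifs <;> norm_num

lemma isNonneg_charPoly (C : Finset Word) : IsNonneg (charPoly C) := fun w => by
  rw [coeff_charPoly]; split_ifs <;> norm_num

lemma IsNonneg.pow {X : NCPoly} (hX : IsNonneg X) (n : ℕ) : IsNonneg (X ^ n) := by
  induction n with
  | zero => simpa using isNonneg_one
  | succ n ih => rw [pow_succ]; exact ih.mul hX

lemma IsNonneg.geom_sum {X : NCPoly} (hX : IsNonneg X) (n : ℕ) :
    IsNonneg (∑ i ∈ Finset.range n, X ^ i) := by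
  induction n with
  | zero => intro w; simp
  | succ n ih => rw [Finset.sum_range_succ]; exact ih.add (hX.pow n)

lemma IsNonneg.sub_one {X : NCPoly} (hX : IsNonneg X) (h1 : X.coeff 1 = 1) :
    IsNonneg (X - 1) := fun w => by
  rw [MonoidAlgebra.coeff_sub, Finsupp.sub_apply, coeff_one]
  split_ifs with h
  · rw [← h, h1, sub_self]
  · rw [sub_zero]; exact hX w

/-- All words occurring in `Y` have length at least `k`. -/
def MinLength (k : ℕ) (Y : NCPoly) : Prop := ∀ w, w.length < k → Y.coeff w = 0

lemma MinLength.mul {k l : ℕ} {X Y : NCPoly} (hX : MinLength k X) (hY : MinLength l Y) :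
    MinLength (k + l) (X * Y) := fun w hw =>
  coeff_mul_eq_zero fun u v huv hu => hY v <| by
    have hk : k ≤ u.length := not_lt.1 fun h => hu (hX u h)
    rw [← huv, length_mul] at hw
    omega

lemma minLength_zero (X : NCPoly) : MinLength 0 X := fun _ h => absurd h (Nat.not_lt_zero _)

lemma MinLength.pow {X : NCPoly} (hX : MinLength 1 X) (n : ℕ) : MinLength n (X ^ n) := by
  induction n with
  | zero => exact minLength_zero _
  | succ n ih => rw [pow_succ]; exact ih.mul hX

lemma minLength_one_of_coeff_one {X : NCPoly} (h : X.coeff 1 = 0) : MinLength 1 X := fun w hw => by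
  rw [Nat.lt_one_iff, length_eq_zero] at hw
  rw [hw, h]

/-- A factor with constant term `1` can be cancelled on the right when comparing polynomials up
to a given length: such a factor is invertible as a power series. -/
lemma MinLength.of_mul {n : ℕ} {Y S : NCPoly} (hS : S.coeff 1 = 1) (h : MinLength n (Y * S)) :
    MinLength n Y := by
  have hS' : MinLength 1 (S - 1) := minLength_one_of_coeff_one <| by
    rw [MonoidAlgebra.coeff_sub, Finsupp.sub_apply, hS, coeff_one, if_pos rfl, sub_self]
  have key : ∀ k ≤ n, MinLength k Y := by
    intro k
    induction k with
    | zero => exact fun _ => minLength_zero _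
    | succ k ih =>
      intro hk w hw
      have h1 := ((ih (by omega)).mul hS') w hw
      rw [mul_sub, mul_one, MonoidAlgebra.coeff_sub, Finsupp.sub_apply, h w (by omega)] at h1
      omega
  exact key n le_rfl

/-- If `X (1 - A) - 1` only involves words of length at least `n`, then all words shorter than
`n` have coefficient `1` in `X`. -/
lemma coeff_eq_one_of_minLength {n : ℕ} {X : NCPoly}
    (h : MinLength n (X * (1 - (mono wa + mono wb)) - 1)) (w : Word) (hw : w.length < n) :
    X.coeff w = 1 := by
  have expand : X * (1 - (mono wa + mono wb)) - 1 = X - X * mono wa - X * mono wb - 1 := by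
    noncomm_ring
  rw [expand] at h
  have hne : ∀ (l m : Letter) (u : Word), l ≠ m → (X * mono (of l)).coeff (u * of m) = 0 := by
    intro l m u hlm
    refine coeff_mul_eq_zero fun s t hst _ => ?_
    rw [coeff_mono, if_neg]
    rintro rfl
    exact hlm (mul_of_inj hst).2
  have hone : ∀ l : Letter, (X * mono (of l)).coeff 1 = 0 := by
    intro l
    refine coeff_mul_eq_zero fun s t hst _ => ?_
    rw [coeff_mono, if_neg]
    rintro rfl
    simpa using congrArg FreeMonoid.length hst
  -- words are peeled from the right, since `1 - A` multiplies `X` on the right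
  have key : ∀ L : List Letter, L.length < n → X.coeff (ofList L) = 1 := by
    intro L
    induction L using List.reverseRecOn with
    | nil =>
      intro hn
      have := h 1 hn
      simp only [MonoidAlgebra.coeff_sub, Finsupp.sub_apply, hone, coeff_one, if_true] at this
      rw [ofList_nil]
      omega
    | append_singleton L l ih =>
      intro hn
      rw [List.length_append, List.length_singleton] at hn
      have hL := ih (by omega)
      rw [ofList_append, ofList_singleton]
      have h1 : (1 : NCPoly).coeff (ofList L * of l) = 0 := by
        rw [coeff_one, if_neg]
        intro h
        have := congrArg FreeMonoid.length h
        simp at this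
      have := h (ofList L * of l) (by rw [length_mul, length_of]; exact hn)
      simp only [MonoidAlgebra.coeff_sub, Finsupp.sub_apply, h1] at this
      cases l with
      | a =>
        rw [coeff_mul_mono, hne _ _ _ (by decide)] at this
        omega
      | b =>
        rw [coeff_mul_mono, hne _ _ _ (by decide)] at this
        omega
  exact key (toList w) hw

/-- In the power series ring `A* = S C* P`, so nonnegativity of `P` and `S` bounds their
coefficients by those of `A*`. Here `C*` is replaced by its partial sums. -/
lemma hasZeroOneCoeffs_of_isNonneg {C : Finset Word} {P S : NCPoly} (hPS : IsFactorization C P S)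
    (hC1 : 1 ∉ C) (hP : IsNonneg P) (hS : IsNonneg S) (hP1 : P.coeff 1 = 1)
    (hS1 : S.coeff 1 = 1) : HasZeroOneCoeffs P ∧ HasZeroOneCoeffs S := by
  set c := charPoly C with hc
  have hcn : IsNonneg c := isNonneg_charPoly C
  have hfac : P * (1 - (mono wa + mono wb)) * S = 1 - c := by
    rw [hc, hPS]; noncomm_ring
  have hcl : MinLength 1 c := minLength_one_of_coeff_one <| by
    rw [hc, coeff_charPoly, if_neg hC1]
  have hX : ∀ w : Word,
      (S * (∑ i ∈ Finset.range (w.length + 1), c ^ i) * P).coeff w = 1 := by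
    intro w
    refine coeff_eq_one_of_minLength (n := w.length + 1) (MinLength.of_mul hS1 ?_) w
      (Nat.lt_succ_self _)
    have : (S * (∑ i ∈ Finset.range (w.length + 1), c ^ i) * P * (1 - (mono wa + mono wb)) - 1) * S
        = (-S) * c ^ (w.length + 1) := by
      calc _ = S * ((∑ i ∈ Finset.range (w.length + 1), c ^ i) *
            (P * (1 - (mono wa + mono wb)) * S)) - S := by noncomm_ring
        _ = _ := by rw [hfac, geom_sum_mul_neg]; noncomm_ring
    rw [this]
    simpa using (minLength_zero (-S)).mul (hcl.pow (w.length + 1))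
  have hsplit : ∀ n, ∑ i ∈ Finset.range (n + 1), c ^ i
      = 1 + (∑ i ∈ Finset.range n, c ^ i) * c := fun n => by
    rw [Finset.sum_range_succ', pow_zero, add_comm, Finset.sum_mul]
    simp only [pow_succ]
  have hrest : ∀ n, IsNonneg (S * ((∑ i ∈ Finset.range n, c ^ i) * c) * P) := fun n =>
    (hS.mul ((hcn.geom_sum n).mul hcn)).mul hP
  have hSP : ∀ w, (S * P).coeff w ≤ 1 := fun w => by
    have h1 := hX w
    rw [hsplit, mul_add, add_mul, mul_one, MonoidAlgebra.coeff_add, Finsupp.add_apply] at h1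
    linarith [hrest w.length w]
  refine ⟨fun w => ?_, fun w => ?_⟩
  · have h1 := ((hS.sub_one hS1).mul hP) w
    rw [sub_mul, one_mul, MonoidAlgebra.coeff_sub, Finsupp.sub_apply] at h1
    have := hP w
    have := hSP w
    omega
  · have h1 := (hS.mul (hP.sub_one hP1)) w
    rw [mul_sub, mul_one, MonoidAlgebra.coeff_sub, Finsupp.sub_apply] at h1
    have := hS w
    have := hSP w
    omega

/-! ### Nonnegativity of the factors -/

/-- The words of `S` with a letter `b` end in `b a ^ j` with `j < n`, so they do not contribute to
the coefficient of `x a ^ n` in `P (A - 1) S`; only `P (a - 1)(1 + ⋯ + a ^ (n - 1)) = P (a ^ n - 1)`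
does. -/
lemma coeff_charPoly_mul_wa_pow {C : Finset Word} {P S : NCPoly} (hPS : IsFactorization C P S)
    {n : ℕ} (hn : 0 < n)
    (hS : ∀ y, (S - ∑ j ∈ Finset.range n, mono wa ^ j).coeff y ≠ 0 →
      ∃ i j, j < n ∧ y = wa ^ i * wb * wa ^ j) (x : Word) :
    (charPoly C).coeff (x * wa ^ n) = P.coeff x - P.coeff (x * wa ^ n) := by
  set U := S - ∑ j ∈ Finset.range n, mono wa ^ j with hU
  have hD : charPoly C = P * mono (wa ^ n) - P + P * (mono wb * ∑ j ∈ Finset.range n, mono wa ^ j)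
      + P * (mono wa + mono wb - 1) * U + 1 := by
    have hSU : S = U + ∑ j ∈ Finset.range n, mono wa ^ j := by rw [hU, sub_add_cancel]
    have hg := mul_geom_sum (mono wa) n
    rw [hPS]
    conv_lhs => rw [hSU]
    rw [mono_pow]
    calc _ = P * ((mono wa - 1) * ∑ j ∈ Finset.range n, mono wa ^ j)
          + P * (mono wb * ∑ j ∈ Finset.range n, mono wa ^ j)
          + P * (mono wa + mono wb - 1) * U + 1 := by noncomm_ring
      _ = _ := by rw [hg]; noncomm_ring
  have h1 : (P * (mono wb * ∑ j ∈ Finset.range n, mono wa ^ j)).coeff (x * wa ^ n) = 0 := by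
    refine coeff_mul_eq_zero fun u v huv _ => ?_
    rw [Finset.mul_sum, MonoidAlgebra.coeff_sum, Finsupp.finsetSum_apply]
    refine Finset.sum_eq_zero fun j hj => ?_
    rw [← mono_pow, ← mono_mul, coeff_mono, if_neg]
    rintro rfl
    exact mul_wb_mul_wa_pow_ne (Finset.mem_range.1 hj) u x (by rw [← huv, mul_assoc])
  have h2 : (P * (mono wa + mono wb - 1) * U).coeff (x * wa ^ n) = 0 := by
    refine coeff_mul_eq_zero fun u v huv _ => ?_
    by_contra hv
    obtain ⟨i, j, hj, rfl⟩ := hS v hv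
    exact mul_wb_mul_wa_pow_ne hj (u * wa ^ i) x (by rw [← huv]; simp only [mul_assoc])
  have h3 : (1 : NCPoly).coeff (x * wa ^ n) = 0 := by
    rw [coeff_one, if_neg]
    intro h
    have := congrArg FreeMonoid.length h
    rw [length_mul, length_wa_pow, length_one] at this
    omega
  rw [hD]
  simp only [MonoidAlgebra.coeff_add, MonoidAlgebra.coeff_sub, Finsupp.add_apply,
    Finsupp.sub_apply, coeff_mul_mono, h1, h2, h3]
  ring

/-- If a nonnegative amount is lost from the coefficient of `x` to that of `x a ^ n`, then iterating
`x ↦ x a ^ n` until the support of `P` is left shows that `P` is nonnegative. -/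
lemma isNonneg_of_coeff_mul_wa_pow_le {P : NCPoly} {n : ℕ} (hn : 0 < n)
    (h : ∀ x, P.coeff (x * wa ^ n) ≤ P.coeff x) : IsNonneg P := by
  intro x
  have hk : ∀ k : ℕ, P.coeff (x * wa ^ (n * k)) ≤ P.coeff x := by
    intro k
    induction k with
    | zero => simp
    | succ k ih =>
      rw [Nat.mul_succ, pow_add, ← mul_assoc]
      exact (h _).trans ih
  have hinj : Function.Injective fun k : ℕ => x * wa ^ (n * k) := fun k l hkl =>
    Nat.eq_of_mul_eq_mul_left hn (wa_pow_injective (mul_left_cancel hkl))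
  obtain ⟨k, hk'⟩ := Infinite.exists_notMem_finset
    (P.coeff.support.preimage _ hinj.injOn)
  rw [Finset.mem_preimage, Finsupp.notMem_support_iff] at hk'
  exact hk' ▸ hk k

/-- Let `x` be a word of `P` with the largest number of letters `b`. The coefficient of `x b y` in
the characteristic polynomial of `C` is `P x * S y` for the words `y` with exactly one `b`. -/
lemma coeff_charPoly_mul_wb_mul {C : Finset Word} {P S : NCPoly} (hPS : IsFactorization C P S)
    (hS : ∀ y, S.coeff y ≠ 0 → bCount y ≤ 1) {x : Word}
    (hx : ∀ u, P.coeff u ≠ 0 → bCount u ≤ bCount x) {y : Word} (hy : bCount y = 1) :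
    (charPoly C).coeff (x * wb * y) = P.coeff x * S.coeff y := by
  have hD : charPoly C = P * (mono wa - 1) * S + P * mono wb * S + 1 := by
    rw [hPS]; noncomm_ring
  have h1 : (P * (mono wa - 1) * S).coeff (x * wb * y) = 0 := by
    refine coeff_mul_eq_zero fun u v huv hu => ?_
    by_contra hv
    obtain ⟨s, t, rfl, hs, ht⟩ := exists_of_coeff_mul_ne_zero hu
    have ht' : bCount t = 0 := by
      rw [MonoidAlgebra.coeff_sub, Finsupp.sub_apply, coeff_mono, coeff_one] at ht
      by_cases hta : wa = t
      · rw [← hta, bCount_wa]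
      · by_cases ht1 : 1 = t
        · rw [← ht1, bCount_one]
        · simp [hta, ht1] at ht
    have hb := congrArg bCount huv
    simp only [bCount_mul, bCount_wb] at hb
    have := hS v hv
    have := hx s hs
    omega
  have h2 : (P * mono wb * S).coeff (x * wb * y) = P.coeff x * S.coeff y := by
    rw [← coeff_mul_mono P x wb]
    refine MonoidAlgebra.coeff_mul_mul_of_uniqueMul fun u v hu hv huv => ?_
    rw [Finsupp.mem_support_iff] at hu hv
    obtain ⟨s, t, rfl, hs, ht⟩ := exists_of_coeff_mul_ne_zero hu
    obtain rfl : wb = t := by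
      by_contra hne
      exact ht (by rw [coeff_mono, if_neg hne])
    have hb := congrArg bCount huv
    simp only [bCount_mul, bCount_wb] at hb
    have := hS v hv
    have := hx s hs
    obtain ⟨rfl, rfl⟩ := mul_wb_mul_inj (by omega) huv
    exact ⟨rfl, rfl⟩
  have h3 : (1 : NCPoly).coeff (x * wb * y) = 0 := by
    rw [coeff_one, if_neg]
    intro h
    have hb := congrArg bCount h
    simp only [bCount_mul, bCount_wb, bCount_one] at hb
    omega
  rw [hD]
  simp only [MonoidAlgebra.coeff_add, Finsupp.add_apply, h1, h2, h3]
  ring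

/-- A factorization with `S₀ = 1 + a + ⋯ + a ^ (n - 1)` and `P(1) = 1` has coefficients `0` and `1`;
both factors are shown to be nonnegative first. -/
lemma hasZeroOneCoeffs_of_coeff_wa_pow {C : Finset Word} {P S : NCPoly}
    (hPS : IsFactorization C P S) (hC1 : 1 ∉ C) {n : ℕ} (hn : 0 < n)
    (hS : S = bPart 0 S + bPart 1 S)
    (hsupp : ∀ i j : ℕ, wa ^ i * wb * wa ^ j ∈ supp S → wa ^ j ∈ supp S)
    (hP1 : P.coeff 1 = 1) (hS0 : ∀ j, S.coeff (wa ^ j) = if j < n then 1 else 0) :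
    HasZeroOneCoeffs P ∧ HasZeroOneCoeffs S := by
  have hSb : ∀ y, S.coeff y ≠ 0 → bCount y ≤ 1 := by
    intro y hy
    by_contra hlt
    apply hy
    rw [hS, MonoidAlgebra.coeff_add, Finsupp.add_apply, bPart, bPart, MonoidAlgebra.coeff_ofCoeff,
      MonoidAlgebra.coeff_ofCoeff, Finsupp.filter_apply_neg _ _ (by omega),
      Finsupp.filter_apply_neg _ _ (by omega), add_zero]
  have hgeom : ∀ y, (∑ j ∈ Finset.range n, mono wa ^ j).coeff y
      = ∑ j ∈ Finset.range n, if wa ^ j = y then (1 : ℤ) else 0 := fun y => by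
    simp only [MonoidAlgebra.coeff_sum, Finsupp.finsetSum_apply, ← mono_pow, coeff_mono]
  have hU : ∀ y, (S - ∑ j ∈ Finset.range n, mono wa ^ j).coeff y ≠ 0 →
      ∃ i j, j < n ∧ y = wa ^ i * wb * wa ^ j := by
    intro y hy
    rw [MonoidAlgebra.coeff_sub, Finsupp.sub_apply, hgeom] at hy
    rcases Nat.eq_zero_or_pos (bCount y) with h0 | hpos
    · obtain ⟨k, rfl⟩ := exists_eq_wa_pow h0
      refine absurd ?_ hy
      rw [hS0]
      simp [wa_pow_injective.eq_iff]
    · have hz : ∑ j ∈ Finset.range n, (if wa ^ j = y then (1 : ℤ) else 0) = 0 := by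
        refine Finset.sum_eq_zero fun j _ => if_neg ?_
        rintro rfl
        rw [bCount_wa_pow] at hpos
        omega
      rw [hz, sub_zero] at hy
      obtain ⟨i, j, rfl⟩ := exists_eq_wa_pow_mul (le_antisymm (hSb y hy) hpos)
      refine ⟨i, j, ?_, rfl⟩
      have hj : S.coeff (wa ^ j) ≠ 0 := hsupp i j hy
      by_contra hjn
      exact hj (by rw [hS0, if_neg hjn])
  have hP : IsNonneg P := isNonneg_of_coeff_mul_wa_pow_le hn fun x => by
    have := coeff_charPoly_mul_wa_pow hPS hn hU x
    linarith [isNonneg_charPoly C (x * wa ^ n)]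
  have hSn : IsNonneg S := by
    obtain ⟨x, hx, hmax⟩ := P.coeff.support.exists_max_image bCount
      ⟨1, Finsupp.mem_support_iff.2 (by rw [hP1]; exact one_ne_zero)⟩
    rw [Finsupp.mem_support_iff] at hx
    intro y
    rcases lt_trichotomy (bCount y) 1 with h | h | h
    · obtain ⟨k, rfl⟩ := exists_eq_wa_pow (Nat.lt_one_iff.1 h)
      rw [hS0]
      split_ifs <;> norm_num
    · have := coeff_charPoly_mul_wb_mul hPS hSb
        (fun u hu => hmax u (Finsupp.mem_support_iff.2 hu)) h
      refine nonneg_of_mul_nonneg_right (a := P.coeff x) ?_ (lt_of_le_of_ne (hP x) hx.symm)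
      exact this ▸ isNonneg_charPoly C _
    · by_contra hneg
      exact absurd (hSb y (by omega)) (by omega)
  exact hasZeroOneCoeffs_of_isNonneg hPS hC1 hP hSn hP1 (by simpa [hn] using hS0 0)

/-! ### The part without `b` -/

/-- The substitution `a ↦ X`, `b ↦ 0`. -/
noncomputable def toPoly : NCPoly →+* ℤ[X] :=
  (MonoidAlgebra.lift ℤ ℤ[X] Word (FreeMonoid.lift fun l => match l with
    | Letter.a => X
    | Letter.b => 0)).toRingHom

lemma toPoly_mono_wa : toPoly (mono wa) = X := by
  simp [toPoly, mono]

lemma toPoly_mono_wb : toPoly (mono wb) = 0 := by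
  simp [toPoly, mono]

lemma toPoly_mono (w : Word) :
    toPoly (mono w) = if bCount w = 0 then X ^ w.length else 0 := by
  induction w using FreeMonoid.inductionOn' with
  | one => simp [bCount_one, mono, MonoidAlgebra.of, ← MonoidAlgebra.one_def]
  | of_mul l w ih =>
    rw [mono_mul, map_mul, ih, bCount_mul, length_mul]
    cases l with
    | a =>
      rw [toPoly_mono_wa, bCount_wa, zero_add, length_of, pow_add, pow_one]
      split_ifs <;> simp
    | b => rw [toPoly_mono_wb, bCount_wb, zero_mul, if_neg (Nat.add_one_ne_zero _ ∘ (Nat.add_comm _ _).trans)]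

lemma coeff_toPoly (P : NCPoly) (k : ℕ) : (toPoly P).coeff k = P.coeff (wa ^ k) := by
  have hP : P = P.coeff.sum fun w r => r • mono w := by
    conv_lhs => rw [← MonoidAlgebra.sum_coeff_single P]
    refine Finsupp.sum_congr fun w _ => ?_
    simp [mono_eq_single, MonoidAlgebra.smul_single]
  have hm : ∀ w, (toPoly (mono w)).coeff k = (mono w).coeff (wa ^ k) := by
    intro w
    rw [toPoly_mono, coeff_mono]
    split_ifs with h0 h1 h1
    · rw [h1, length_wa_pow, coeff_X_pow_self]
    · obtain ⟨j, rfl⟩ := exists_eq_wa_pow h0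
      rw [length_wa_pow, coeff_X_pow, if_neg]
      rintro rfl
      exact h1 rfl
    · rw [h1, bCount_wa_pow] at h0
      exact absurd rfl h0
    · rfl
  rw [hP, Finsupp.sum, map_sum, finsetSum_coeff, MonoidAlgebra.coeff_sum,
    Finsupp.finsetSum_apply]
  refine Finset.sum_congr rfl fun w _ => ?_
  rw [map_zsmul, MonoidAlgebra.coeff_smul, Finsupp.smul_apply, Polynomial.coeff_smul, hm]

lemma IsCode.one_notMem {C : Set Word} (hC : IsCode C) : 1 ∉ C := fun h =>
  InformationTheory.UniquelyDecodable.epsilon_not_mem hC ⟨1, h, rfl⟩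

/-- A code contains at most one power of `a`, since powers of `a` commute. -/
lemma IsCode.wa_pow_unique {C : Set Word} (hC : IsCode C) {p k : ℕ} (hp : wa ^ p ∈ C)
    (hk : wa ^ k ∈ C) : k = p := by
  have hmem : ∀ q : ℕ, wa ^ q ∈ C → ∀ m : ℕ, ∀ w ∈ List.replicate m (toList (wa ^ q)),
      w ∈ toList '' C := fun q hq m w hw => ⟨_, hq, (List.eq_of_mem_replicate hw).symm⟩
  have hflat : ∀ q m : ℕ,
      (List.replicate m (toList (wa ^ q))).flatten = toList (wa ^ (q * m)) := by
    intro q m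
    induction m with
    | zero => rfl
    | succ m ih =>
      rw [List.replicate_succ, List.flatten_cons, ih, ← toList_mul, ← pow_add]
      congr 2
      ring
  have := hC _ _ (hmem p hp k) (hmem k hk p) (by rw [hflat, hflat, mul_comm])
  simpa using congrArg List.length this

lemma toPoly_charPoly {C : Finset Word} (hC : IsCode (C : Set Word)) {p : ℕ}
    (hp : wa ^ p ∈ C) : toPoly (charPoly C) = X ^ p := by
  ext k
  rw [coeff_toPoly, coeff_charPoly, coeff_X_pow]
  by_cases h : k = p
  · rw [h, if_pos hp, if_pos rfl]
  · rw [if_neg h, if_neg fun hk =>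
      h (hC.wa_pow_unique (Finset.mem_coe.2 hp) (Finset.mem_coe.2 hk))]

/-- Substituting `b = 0` gives `P₀ S₀ = 1 + X + ⋯ + X ^ (p - 1)`, which is irreducible for prime
`p`. -/
lemma exists_coeff_wa_pow_eq {C : Finset Word} (hC : IsCode (C : Set Word)) {p : ℕ}
    (hp : p.Prime) (hpC : wa ^ p ∈ C) {P S : NCPoly} (hPS : IsFactorization C P S) :
    ∃ n, 0 < n ∧ ∃ ε : ℤ, (ε = 1 ∨ ε = -1) ∧ P.coeff 1 = ε ∧
      ∀ j, S.coeff (wa ^ j) = ε * if j < n then 1 else 0 := by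
  have : Fact p.Prime := ⟨hp⟩
  have hgeom : ∀ j, (∑ i ∈ Finset.range p, (X : ℤ[X]) ^ i).coeff j = if j < p then 1 else 0 := by
    intro j
    simp [finsetSum_coeff, coeff_X_pow]
  have hmul : toPoly P * toPoly S = ∑ i ∈ Finset.range p, (X : ℤ[X]) ^ i := by
    have h := congrArg toPoly hPS
    rw [toPoly_charPoly hC hpC, map_add, map_mul, map_mul, map_sub, map_add, map_one,
      toPoly_mono_wa, toPoly_mono_wb] at h
    refine mul_left_cancel₀ (X_sub_C_ne_zero (1 : ℤ)) ?_
    rw [map_one, mul_geom_sum, h]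
    ring
  have hirr : Irreducible (∑ i ∈ Finset.range p, (X : ℤ[X]) ^ i) := by
    rw [← cyclotomic_prime]
    exact cyclotomic.irreducible hp.pos
  have hunit : ∀ f : ℤ[X], IsUnit f → ∃ ε : ℤ, (ε = 1 ∨ ε = -1) ∧ f = Polynomial.C ε := by
    intro f hf
    obtain ⟨r, hr, rfl⟩ := isUnit_iff.1 hf
    exact ⟨r, Int.isUnit_iff.1 hr, rfl⟩
  have hP1 : P.coeff 1 = (toPoly P).coeff 0 := by rw [coeff_toPoly, pow_zero]
  simp only [← coeff_toPoly, hP1]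
  rcases hirr.isUnit_or_isUnit hmul.symm with h | h
  · obtain ⟨ε, hε, hf⟩ := hunit _ h
    refine ⟨p, hp.pos, ε, hε, by rw [hf, coeff_C_zero], fun j => ?_⟩
    have hj := congrArg (fun f => ε * f.coeff j) hmul
    simp only [hf, hgeom, coeff_C_mul] at hj
    rw [← hj, ← mul_assoc]
    rcases hε with rfl | rfl <;> simp
  · obtain ⟨ε, hε, hf⟩ := hunit _ h
    refine ⟨1, one_pos, ε, hε, ?_, fun j => ?_⟩
    · have hj := congrArg (fun f => f.coeff 0 * ε) hmul
      simp only [hf, hgeom, coeff_mul_C, if_pos hp.pos] at hj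
      rcases hε with rfl | rfl <;> linarith
    · rw [hf, coeff_C]
      simp

end FactorizationConjecture

open FactorizationConjecture in
theorem mainTheorem1
    (C : Finset FactorizationConjecture.Word)
    (hC : FactorizationConjecture.IsMaximalCode (C : Set FactorizationConjecture.Word))
    (p : ℕ) (hp : p.Prime) (hpC : FactorizationConjecture.wa ^ p ∈ C)
    (P S : FactorizationConjecture.NCPoly)
    (hS : S = FactorizationConjecture.bPart 0 S + FactorizationConjecture.bPart 1 S)
    (hsupp : ∀ i j : ℕ,
      FactorizationConjecture.wa ^ i * FactorizationConjecture.wb * FactorizationConjecture.wa ^ j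
          ∈ FactorizationConjecture.supp S →
        FactorizationConjecture.wa ^ j ∈ FactorizationConjecture.supp S)
    (hPS : FactorizationConjecture.IsFactorization C P S) :
    FactorizationConjecture.IsPositivePair P S := by
  have hcode : IsCode (C : Set Word) := hC.prop
  have hC1 : 1 ∉ C := fun h => hcode.one_notMem (Finset.mem_coe.2 h)
  obtain ⟨n, hn, ε, rfl | rfl, hP1, hS0⟩ := exists_coeff_wa_pow_eq hcode hp hpC hPS
  · exact Or.inl (hasZeroOneCoeffs_of_coeff_wa_pow hPS hC1 hn hS hsupp hP1
      (fun j => by rw [hS0, one_mul]))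
  · -- `(-P, -S)` satisfies the same hypotheses
    have hb : ∀ g, bPart g (-S) = -bPart g S := fun g =>
      MonoidAlgebra.coeff_injective (Finsupp.filter_neg _ _)
    have hs : ∀ w, w ∈ supp (-S) ↔ w ∈ supp S := fun w => by
      simp [supp]
    refine Or.inr (hasZeroOneCoeffs_of_coeff_wa_pow (C := C) ?_ hC1 hn ?_ ?_ ?_ ?_)
    · rw [IsFactorization, neg_mul, neg_mul, mul_neg, neg_neg]
      exact hPS
    · rw [hb, hb, ← neg_add, ← hS]
    · exact fun i j h => (hs _).2 (hsupp i j ((hs _).1 h))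
    · simp [hP1]
    · intro j
      rw [MonoidAlgebra.coeff_neg, Finsupp.neg_apply, hS0, neg_one_mul, neg_neg]
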